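/- Call a real random field $X=\{X_{i,j}\}_{i,j\in\mathbb Z}$ with finite variances (wide-sense) stationary if $\mathsf E X_{i,j}$ does not depend on $(i,j)$ and $\gamma_X(h_1,h_2)=\operatorname{cov}(X_{i,j},X_{i-h_1,j-h_2})$ depends only on $(h_1,h_2)$; $\gamma_X$ is its autocovariance function. Let $$\Theta=\{(a,b,c,v)\in\mathbb R^4:\ (1-a-b-c)(1-a+b+c)(1+a-b+c)(1+a+b-c)>0,\ v>0\}$$ and consider the maps $$T_1(a,b,c,v)=(a,b,c,v),\qquad T_2(a,b,c,v)=\Bigl(-\tfrac bc,-\tfrac ac,\tfrac1c,\tfrac v{c^2}\Bigr),$$ $$T_3(a,b,c,v)=\Bigl(\tfrac1a,-\tfrac ca,-\tfrac ba,\tfrac v{a^2}\Bigr),\qquad T_4(a,b,c,v)=\Bigl(-\tfrac cb,\tfrac1b,-\tfrac ab,\tfrac v{b^2}\Bigr),$$ defined on $\Theta_1=\Theta$, $\Theta_2=\{\theta\in\Theta: c\ne0\}$, $\Theta_3=\{\theta\in\Theta: a\ne0\}$ and $\Theta_4=\{\theta\in\Theta: b\ne0\}$ respectively. (They give the parameters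 of the autoregressive equations satisfied by the fields $X_{i,j}$, $X_{-i,-j}$, $X_{-i,j}$ and $X_{i,-j}$.) **Proposition.** For $k=1,2$, let $\theta_k=(a_k,b_k,c_k,\sigma_{\epsilon,k}^2)$ with $a_k,b_k,c_k\in\mathbb R$ and $\sigma_{\epsilon,k}^2>0$, let $\epsilon^{(k)}_{i,j}$, $i,j\in\mathbb Z$, be uncorrelated zero-mean random variables with variance $\sigma_{\epsilon,k}^2$, and let $X^{(k)}$ be a stationary field such that, almost surely, $$X^{(k)}_{i,j}=a_kX^{(k)}_{i-1,j}+b_kX^{(k)}_{i,j-1}+c_kX^{(k)}_{i-1,j-1}+\epsilon^{(k)}_{i,j}\qquad\text{for all } i,j\in\mathbb Z .$$ (The two fields may live on different probability spaces.) If $\gamma_{X^{(1)}}(h_1,h_2)=\gamma_{X^{(2)}}(h_1,h_2)$ for all $h_1,h_2\in\mathbb Z$, then there are $\theta_0\in\Theta$ and $m,n\in\{1,2,3,4\}$ with $\theta_0\in\Theta_m\cap\Theta_n$, $\theta_1=T_m\theta_0$ and $\theta_2=T_n\theta_0$. Moreover, $\theta_1\in\Theta_m$ and $\theta_2=T_m\theta_1$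 for some $m\in\{1,2,3,4\}$. -/

import Mathlib

open MeasureTheory ProbabilityTheory

namespace PlanarAR

/-- A parameter quadruple `(a, b, c, v)`; `v` is the error variance `σ_ε²`. -/
@[ext]
structure Params where
  a : ℝ
  b : ℝ
  c : ℝ
  v : ℝ

/-- The parameter set `Θ`. -/
def paramSet : Set Params :=
  {θ | 0 < (1 - θ.a - θ.b - θ.c) * (1 - θ.a + θ.b + θ.c) *
          (1 + θ.a - θ.b + θ.c) * (1 + θ.a + θ.b - θ.c) ∧ 0 < θ.v}

/-- The four rows of the correspondence table. They are the parameters of the equations satisfied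
by `X_{i,j}`, `X_{-i,-j}`, `X_{-i,j}` and `X_{i,-j}`, in this order. -/
inductive Row where
  | identity
  | flipBoth
  | flipFirst
  | flipSecond

/-- The subset `Θ_m` of `Θ` on which the `m`-th row makes sense (the denominators are nonzero). -/
def Row.domain : Row → Set Params
  | .identity => paramSet
  | .flipBoth => {θ | θ ∈ paramSet ∧ θ.c ≠ 0}
  | .flipFirst => {θ | θ ∈ paramSet ∧ θ.a ≠ 0}
  | .flipSecond => {θ | θ ∈ paramSet ∧ θ.b ≠ 0}

/-- The map `T_m` taking the first row of the table to the `m`-th one (used on `Row.domain`). -/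
noncomputable def Row.map : Row → Params → Params
  | .identity, θ => θ
  | .flipBoth, θ => ⟨-θ.b / θ.c, -θ.a / θ.c, 1 / θ.c, θ.v / θ.c ^ 2⟩
  | .flipFirst, θ => ⟨1 / θ.a, -θ.c / θ.a, -θ.b / θ.a, θ.v / θ.a ^ 2⟩
  | .flipSecond, θ => ⟨-θ.c / θ.b, 1 / θ.b, -θ.a / θ.b, θ.v / θ.b ^ 2⟩

/-- Two quadruples are related as rows of the table: both are rows of the table that is built from
one and the same quadruple `θ₀ ∈ Θ`. -/
def RelatedAsRows (θ₁ θ₂ : Params) : Prop :=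
  ∃ θ₀ ∈ paramSet, ∃ m n : Row,
    θ₀ ∈ m.domain ∧ θ₀ ∈ n.domain ∧ θ₁ = m.map θ₀ ∧ θ₂ = n.map θ₀

section Fields

variable {Ω : Type*} [MeasurableSpace Ω]

/-- The autocovariance function `γ_X(h₁, h₂) = cov(X_{i,j}, X_{i-h₁,j-h₂})`, evaluated at
`i = j = 0`; for wide-sense stationary fields the choice of `(i, j)` does not matter. -/
noncomputable def autocov (X : ℤ → ℤ → Ω → ℝ) (μ : Measure Ω) (h₁ h₂ : ℤ) : ℝ :=
  cov[X 0 0, X (-h₁) (-h₂); μ]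

/-- Wide-sense stationary real random fields on the integer lattice. -/
structure IsWideSenseStationary (X : ℤ → ℤ → Ω → ℝ) (μ : Measure Ω) : Prop where
  memLp : ∀ i j, MemLp (X i j) 2 μ
  mean_eq : ∀ i j, μ[X i j] = μ[X 0 0]
  cov_eq : ∀ i j h₁ h₂, cov[X i j, X (i - h₁) (j - h₂); μ] = autocov X μ h₁ h₂

/-- Collections of uncorrelated zero-mean random variables with equal variance `v > 0`. -/
structure IsWhiteNoise (ε : ℤ → ℤ → Ω → ℝ) (v : ℝ) (μ : Measure Ω) : Prop where
  var_pos : 0 < v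
  memLp : ∀ i j, MemLp (ε i j) 2 μ
  mean_eq_zero : ∀ i j, μ[ε i j] = 0
  variance_eq : ∀ i j, Var[ε i j; μ] = v
  uncorrelated : ∀ i j k l, (i, j) ≠ (k, l) → cov[ε i j, ε k l; μ] = 0

/-- `X` is a (wide-sense) stationary field that satisfies the first-order planar autoregressive
equation with parameters `θ` and error field `ε`. -/
structure IsStationaryAR (θ : Params) (X ε : ℤ → ℤ → Ω → ℝ) (μ : Measure Ω) : Prop where
  stationary : IsWideSenseStationary X μ
  noise : IsWhiteNoise ε θ.v μ
  equation : ∀ i j, ∀ᵐ ω ∂μ, X i j ω =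
    θ.a * X (i - 1) j ω + θ.b * X i (j - 1) ω + θ.c * X (i - 1) (j - 1) ω + ε i j ω

end Fields

end PlanarAR

/-! Let P(z, w) = 1 - az - bw - czw. Expanding the covariance of two errors gives P(S)P(S⁻¹)γ = v
δ₀, with no causality assumed. If two models share γ, commuting the operators yields v₂|P₁|² =
v₁|P₂|² on the torus (`coefficients_of_arOp_arOpAdj_eq`). Up to sign, the only real polynomials of
this shape with a given |P|² are P and its reflections (`eq_or_flip_of_symbol_eq`); normalising the
constant term to 1 turns them into the four rows.

That θ₁ lies in Θ needs analysis: outside Θ, P vanishes somewhere on the torus. By duality and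
Cauchy–Schwarz, (v f(0))² ≤ γ(0) v ‖P(S⁻¹)f‖² for finitely supported f (`IsOrthogonalAR.sq_le`). For
f the real part of the character at the zero times a logarithmic cutoff, f(0) = 1 while the right
side tends to 0, as in the zero capacity of a point in the plane. -/

namespace PlanarAR

/-! ### Autoregressive operators and their symbols -/

/-- The operator `g ↦ P(S) g`, `S` the backward shifts, `P(z, w) = 1 - a z - b w - c z w`. -/
def arOp (θ : Params) (g : ℤ × ℤ → ℝ) (p : ℤ × ℤ) : ℝ :=
  g p - θ.a * g (p - (1, 0)) - θ.b * g (p - (0, 1)) - θ.c * g (p - (1, 1))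

/-- The formal adjoint of `arOp`. -/
def arOpAdj (θ : Params) (g : ℤ × ℤ → ℝ) (p : ℤ × ℤ) : ℝ :=
  g p - θ.a * g (p + (1, 0)) - θ.b * g (p + (0, 1)) - θ.c * g (p + (1, 1))

lemma arOp_comm (θ θ' : Params) (g : ℤ × ℤ → ℝ) : arOp θ (arOp θ' g) = arOp θ' (arOp θ g) := by
  funext p
  have h1 := sub_right_comm p (1, 0) (0, 1)
  have h2 := sub_right_comm p (1, 0) (1, 1)
  have h3 := sub_right_comm p (0, 1) (1, 1)
  simp only [arOp, h1, h2, h3]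
  ring

lemma arOpAdj_comm (θ θ' : Params) (g : ℤ × ℤ → ℝ) :
    arOpAdj θ (arOpAdj θ' g) = arOpAdj θ' (arOpAdj θ g) := by
  funext p
  have h1 := add_right_comm p (1, 0) (0, 1)
  have h2 := add_right_comm p (1, 0) (1, 1)
  have h3 := add_right_comm p (0, 1) (1, 1)
  simp only [arOpAdj, h1, h2, h3]
  ring

lemma arOp_arOpAdj_comm (θ θ' : Params) (g : ℤ × ℤ → ℝ) :
    arOp θ (arOpAdj θ' g) = arOpAdj θ' (arOp θ g) := by
  funext p
  simp only [arOp, arOpAdj, add_sub_right_comm]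
  ring

/-- Applying both second-order operators to γ in either order eliminates γ. -/
lemma coefficients_of_arOp_arOpAdj_eq {θ₁ θ₂ : Params} {γ : ℤ × ℤ → ℝ}
    (h₁ : arOp θ₁ (arOpAdj θ₁ γ) = Pi.single 0 θ₁.v)
    (h₂ : arOp θ₂ (arOpAdj θ₂ γ) = Pi.single 0 θ₂.v) :
    θ₂.v * (1 + θ₁.a ^ 2 + θ₁.b ^ 2 + θ₁.c ^ 2) = θ₁.v * (1 + θ₂.a ^ 2 + θ₂.b ^ 2 + θ₂.c ^ 2) ∧
    θ₂.v * (θ₁.b * θ₁.c - θ₁.a) = θ₁.v * (θ₂.b * θ₂.c - θ₂.a) ∧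
    θ₂.v * (θ₁.a * θ₁.c - θ₁.b) = θ₁.v * (θ₂.a * θ₂.c - θ₂.b) ∧
    θ₂.v * θ₁.c = θ₁.v * θ₂.c ∧
    θ₂.v * (θ₁.a * θ₁.b) = θ₁.v * (θ₂.a * θ₂.b) := by
  have key : arOp θ₁ (arOpAdj θ₁ (Pi.single 0 θ₂.v)) = arOp θ₂ (arOpAdj θ₂ (Pi.single 0 θ₁.v)) := by
    rw [← h₁, ← h₂, ← arOp_arOpAdj_comm θ₂, ← arOp_arOpAdj_comm θ₁, arOp_comm θ₁ θ₂,
      arOpAdj_comm θ₁ θ₂]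
  -- Both sides are even and supported in {-1, 0, 1}², so these five points carry all the
  -- information.
  have k0 := congrFun key (0, 0)
  have k1 := congrFun key (1, 0)
  have k2 := congrFun key (0, 1)
  have k3 := congrFun key (1, 1)
  have k4 := congrFun key (1, -1)
  simp [arOp, arOpAdj, Pi.single_apply] at k0 k1 k2 k3 k4
  refine ⟨?_, ?_, ?_, ?_, ?_⟩ <;> linarith

/-- The nonzero quadruples with given coefficients of `|p + q z + r w + s z w|²` on the torus. -/
lemma eq_or_flip_of_symbol_eq {p q r s p' q' r' s' : ℝ}
    (h0 : p ^ 2 + q ^ 2 + r ^ 2 + s ^ 2 = p' ^ 2 + q' ^ 2 + r' ^ 2 + s' ^ 2)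
    (h1 : p * q + r * s = p' * q' + r' * s') (h2 : p * r + q * s = p' * r' + q' * s')
    (h3 : p * s = p' * s') (h4 : q * r = q' * r') :
    ∃ t : ℝ, t ^ 2 = 1 ∧
      ((p' = t * p ∧ q' = t * q ∧ r' = t * r ∧ s' = t * s) ∨
       (p' = t * s ∧ q' = t * r ∧ r' = t * q ∧ s' = t * p) ∨
       (p' = t * q ∧ q' = t * p ∧ r' = t * s ∧ s' = t * r) ∨
       (p' = t * r ∧ q' = t * s ∧ r' = t * p ∧ s' = t * q)) := by
  have pair : ∀ u v u' v' : ℝ, u ^ 2 + v ^ 2 = u' ^ 2 + v' ^ 2 → u * v = u' * v' →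
      (∃ t : ℝ, t ^ 2 = 1 ∧ u' = t * u ∧ v' = t * v) ∨
      (∃ t : ℝ, t ^ 2 = 1 ∧ u' = t * v ∧ v' = t * u) := by
    intro u v u' v' ha hb
    have hp : (u' + v') ^ 2 = (u + v) ^ 2 := by linarith
    have hm : (u' - v') ^ 2 = (u - v) ^ 2 := by linarith
    rcases sq_eq_sq_iff_eq_or_eq_neg.1 hp with h | h <;>
      rcases sq_eq_sq_iff_eq_or_eq_neg.1 hm with h' | h'
    · exact .inl ⟨1, by norm_num, by linarith, by linarith⟩
    · exact .inr ⟨1, by norm_num, by linarith, by linarith⟩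
    · exact .inr ⟨-1, by norm_num, by linarith, by linarith⟩
    · exact .inl ⟨-1, by norm_num, by linarith, by linarith⟩
  have combine : ∀ t u : ℝ, t ^ 2 = 1 → u ^ 2 = 1 → u = t ∨ u = -t := fun t u ht hu ↦
    sq_eq_sq_iff_eq_or_eq_neg.1 (hu.trans ht.symm)
  -- The sums p + s, q + r and the differences p - s, q - r are each determined up to a swap and a
  -- common sign.
  have hA := pair (p + s) (q + r) (p' + s') (q' + r') (by linarith) (by linarith)
  have hB := pair (p - s) (q - r) (p' - s') (q' - r') (by linarith) (by linarith)
  have straight : ∀ t u : ℝ, t ^ 2 = 1 → u ^ 2 = 1 → p' + s' = t * (p + s) →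
      q' + r' = t * (q + r) → p' - s' = u * (p - s) → q' - r' = u * (q - r) → ∃ t : ℝ, t ^ 2 = 1 ∧
      ((p' = t * p ∧ q' = t * q ∧ r' = t * r ∧ s' = t * s) ∨
       (p' = t * s ∧ q' = t * r ∧ r' = t * q ∧ s' = t * p)) := by
    intro t u ht hu e1 e2 e3 e4
    rcases combine t u ht hu with rfl | rfl
    · exact ⟨u, ht, .inl ⟨by linarith, by linarith, by linarith, by linarith⟩⟩
    · exact ⟨t, ht, .inr ⟨by linarith, by linarith, by linarith, by linarith⟩⟩
  rcases hA with ⟨t, ht, e1, e2⟩ | ⟨t, ht, e1, e2⟩ <;>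
    rcases hB with ⟨u, hu, e3, e4⟩ | ⟨u, hu, e3, e4⟩
  · obtain ⟨t, ht, h | h⟩ := straight t u ht hu e1 e2 e3 e4
    · exact ⟨t, ht, .inl h⟩
    · exact ⟨t, ht, .inr (.inl h)⟩
  -- A swap in only one pair is degenerate: ps = p's' makes the squares of the swapped entries
  -- equal, so the swap is a mere sign change.
  · have : (p - s) ^ 2 = (q - r) ^ 2 := by
      have i1 : (p' + s') ^ 2 = (p + s) ^ 2 := by rw [e1, mul_pow, ht, one_mul]
      have i2 : (p' - s') ^ 2 = (q - r) ^ 2 := by rw [e3, mul_pow, hu, one_mul]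
      linarith
    rcases sq_eq_sq_iff_eq_or_eq_neg.1 this with h | h
    · obtain ⟨t, ht, h | h⟩ := straight t u ht hu e1 e2 (by rw [e3, h]) (by rw [e4, h])
      · exact ⟨t, ht, .inl h⟩
      · exact ⟨t, ht, .inr (.inl h)⟩
    · obtain ⟨t, ht, h | h⟩ := straight t (-u) ht (by rw [neg_sq, hu]) e1 e2
        (by rw [e3, h]; ring) (by rw [e4, h]; ring)
      · exact ⟨t, ht, .inl h⟩
      · exact ⟨t, ht, .inr (.inl h)⟩
  · have : (p + s) ^ 2 = (q + r) ^ 2 := by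
      have i1 : (p' + s') ^ 2 = (q + r) ^ 2 := by rw [e1, mul_pow, ht, one_mul]
      have i2 : (p' - s') ^ 2 = (p - s) ^ 2 := by rw [e3, mul_pow, hu, one_mul]
      linarith
    rcases sq_eq_sq_iff_eq_or_eq_neg.1 this with h | h
    · obtain ⟨t, ht, h | h⟩ := straight t u ht hu (by rw [e1, h]) (by rw [e2, h]) e3 e4
      · exact ⟨t, ht, .inl h⟩
      · exact ⟨t, ht, .inr (.inl h)⟩
    · obtain ⟨t, ht, h | h⟩ := straight (-t) u (by rw [neg_sq, ht]) hu
        (by rw [e1, h]; ring) (by rw [e2, h]; ring) e3 e4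
      · exact ⟨t, ht, .inl h⟩
      · exact ⟨t, ht, .inr (.inl h)⟩
  · rcases combine t u ht hu with rfl | rfl
    · exact ⟨u, ht, .inr (.inr (.inl ⟨by linarith, by linarith, by linarith, by linarith⟩))⟩
    · exact ⟨t, ht, .inr (.inr (.inr ⟨by linarith, by linarith, by linarith, by linarith⟩))⟩

lemma exists_row_of_arOp_arOpAdj_eq {θ₁ θ₂ : Params} {γ : ℤ × ℤ → ℝ}
    (hθ₁ : θ₁ ∈ paramSet) (hv₂ : 0 < θ₂.v)
    (h₁ : arOp θ₁ (arOpAdj θ₁ γ) = Pi.single 0 θ₁.v)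
    (h₂ : arOp θ₂ (arOpAdj θ₂ γ) = Pi.single 0 θ₂.v) :
    ∃ m : Row, θ₁ ∈ m.domain ∧ θ₂ = m.map θ₁ := by
  obtain ⟨k0, k1, k2, k3, k4⟩ := coefficients_of_arOp_arOpAdj_eq h₁ h₂
  have hv₁ : 0 < θ₁.v := hθ₁.2
  obtain ⟨a, b, c, v⟩ := θ₁
  obtain ⟨a', b', c', v'⟩ := θ₂
  dsimp only at *
  obtain ⟨σ, hσ, rfl⟩ : ∃ σ : ℝ, 0 < σ ∧ v = σ ^ 2 := ⟨√v, by positivity, (Real.sq_sqrt hv₁.le).symm⟩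
  obtain ⟨τ, hτ, rfl⟩ : ∃ τ : ℝ, 0 < τ ∧ v' = τ ^ 2 :=
    ⟨√v', by positivity, (Real.sq_sqrt hv₂.le).symm⟩
  -- The factors √v₂ on P₁ and √v₁ on P₂ absorb the variances.
  obtain ⟨t, ht, h⟩ := eq_or_flip_of_symbol_eq (p := τ) (q := -τ * a) (r := -τ * b) (s := -τ * c)
    (p' := σ) (q' := -σ * a') (r' := -σ * b') (s' := -σ * c')
    (by linarith) (by linarith) (by linarith) (by linarith) (by linarith)
  have ht0 : t ≠ 0 := by rintro rfl; norm_num at ht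
  have hτ0 := hτ.ne'
  rcases h with ⟨rfl, e1, e2, e3⟩ | ⟨rfl, e1, e2, e3⟩ | ⟨rfl, e1, e2, e3⟩ | ⟨rfl, e1, e2, e3⟩
  · refine ⟨.identity, hθ₁, ?_⟩
    have := mul_ne_zero ht0 hτ0
    ext <;> simp only [Row.map]
    · apply mul_left_cancel₀ this; linarith
    · apply mul_left_cancel₀ this; linarith
    · apply mul_left_cancel₀ this; linarith
    · rw [mul_pow, ht, one_mul]
  -- The constant term σ = -tτc is positive, so the denominator of this row cannot vanish.
  · have hc : c ≠ 0 := by rintro rfl; simp at hσ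
    refine ⟨.flipBoth, ⟨hθ₁, hc⟩, ?_⟩
    have : t * τ ≠ 0 := mul_ne_zero ht0 hτ0
    ext <;> simp only [Row.map]
    · rw [eq_div_iff hc]; apply mul_left_cancel₀ this; linarith
    · rw [eq_div_iff hc]; apply mul_left_cancel₀ this; linarith
    · rw [eq_div_iff hc]; apply mul_left_cancel₀ this; linarith
    · rw [eq_div_iff (pow_ne_zero 2 hc), mul_pow, ht]; ring
  · have hc : a ≠ 0 := by rintro rfl; simp at hσ
    refine ⟨.flipFirst, ⟨hθ₁, hc⟩, ?_⟩
    have : t * τ ≠ 0 := mul_ne_zero ht0 hτ0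
    ext <;> simp only [Row.map]
    · rw [eq_div_iff hc]; apply mul_left_cancel₀ this; linarith
    · rw [eq_div_iff hc]; apply mul_left_cancel₀ this; linarith
    · rw [eq_div_iff hc]; apply mul_left_cancel₀ this; linarith
    · rw [eq_div_iff (pow_ne_zero 2 hc), mul_pow, ht]; ring
  · have hc : b ≠ 0 := by rintro rfl; simp at hσ
    refine ⟨.flipSecond, ⟨hθ₁, hc⟩, ?_⟩
    have : t * τ ≠ 0 := mul_ne_zero ht0 hτ0
    ext <;> simp only [Row.map]
    · rw [eq_div_iff hc]; apply mul_left_cancel₀ this; linarith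
    · rw [eq_div_iff hc]; apply mul_left_cancel₀ this; linarith
    · rw [eq_div_iff hc]; apply mul_left_cancel₀ this; linarith
    · rw [eq_div_iff (pow_ne_zero 2 hc), mul_pow, ht]; ring

/-! ### Yule–Walker equation and the duality bound -/

section InnerProductSpace

variable {H : Type*} [NormedAddCommGroup H] [InnerProductSpace ℝ H]

/-- A stationary solution of the autoregressive equation with parameters `θ`, orthogonal errors `e`
and autocovariance function `γ`, in an inner product space. -/
structure IsOrthogonalAR (θ : Params) (γ : ℤ × ℤ → ℝ) (x e : ℤ × ℤ → H) : Prop where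
  inner_sub : ∀ p h, inner ℝ (x p) (x (p - h)) = γ h
  error_eq : ∀ p, e p = x p - θ.a • x (p - (1, 0)) - θ.b • x (p - (0, 1)) - θ.c • x (p - (1, 1))
  inner_error : ∀ p q, inner ℝ (e p) (e q) = if p = q then θ.v else 0

namespace IsOrthogonalAR

variable {θ : Params} {γ : ℤ × ℤ → ℝ} {x e : ℤ × ℤ → H}

lemma inner_error_sub (h : IsOrthogonalAR θ γ x e) (p k : ℤ × ℤ) :
    inner ℝ (x p) (e (p - k)) = arOpAdj θ γ k := by
  simp only [h.error_eq, inner_sub_right, inner_smul_right, sub_sub p, h.inner_sub, arOpAdj]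

/-- Expand the first error in ⟨e₀, e₋ₖ⟩; expanding the second is `inner_error_sub`. -/
lemma arOp_arOpAdj (h : IsOrthogonalAR θ γ x e) :
    arOp θ (arOpAdj θ γ) = Pi.single 0 θ.v := by
  funext k
  have hs (s : ℤ × ℤ) : inner ℝ (x (0 - s)) (e (0 - k)) = arOpAdj θ γ (k - s) := by
    rw [← h.inner_error_sub (0 - s)]
    congr 2
    abel
  have h0 := h.inner_error 0 (0 - k)
  rw [h.error_eq 0, inner_sub_left, inner_sub_left, inner_sub_left, real_inner_smul_left,
    real_inner_smul_left, real_inner_smul_left, hs, hs, hs, h.inner_error_sub] at h0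
  rw [arOp, h0, Pi.single_apply]
  simp [eq_comm]

end IsOrthogonalAR

/-- Summation by parts. -/
lemma finsum_mul_arOp (θ : Params) {f : ℤ × ℤ → ℝ} (hf : f.support.Finite) (g : ℤ × ℤ → ℝ) :
    ∑ᶠ p, f p * arOp θ g p = ∑ᶠ p, arOpAdj θ f p * g p := by
  have shift (s : ℤ × ℤ) : ∑ᶠ p, f p * g (p - s) = ∑ᶠ p, f (p + s) * g p := by
    rw [← finsum_comp_equiv (Equiv.addRight s)]
    simp
  have fin1 (s : ℤ × ℤ) : (fun p ↦ f p * g (p - s)).support.Finite :=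
    hf.subset fun p hp ↦ left_ne_zero_of_mul hp
  have fin2 (s : ℤ × ℤ) : (fun p ↦ f (p + s) * g p).support.Finite := by
    refine ((hf.preimage (add_left_injective s).injOn)).subset fun p hp ↦ left_ne_zero_of_mul hp
  have lin (u : ℤ × ℤ → ℤ × ℤ → ℝ) (hu : ∀ s, (u s).support.Finite) :
      ∑ᶠ p, (u 0 p - θ.a * u (1, 0) p - θ.b * u (0, 1) p - θ.c * u (1, 1) p) =
        ∑ᶠ p, u 0 p - θ.a * ∑ᶠ p, u (1, 0) p - θ.b * ∑ᶠ p, u (0, 1) p - θ.c * ∑ᶠ p, u (1, 1) p := by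
    have hu' (t : ℝ) (s : ℤ × ℤ) : (fun p ↦ t * u s p).support.Finite :=
      (hu s).subset fun p hp ↦ right_ne_zero_of_mul hp
    have hsub {v w : ℤ × ℤ → ℝ} (hv : v.support.Finite) (hw : w.support.Finite) :
        (fun p ↦ v p - w p).support.Finite := (hv.union hw).subset (Function.support_sub v w)
    rw [finsum_sub_distrib (hsub (hsub (hu _) (hu' _ _)) (hu' _ _)) (hu' _ _),
      finsum_sub_distrib (hsub (hu _) (hu' _ _)) (hu' _ _), finsum_sub_distrib (hu _) (hu' _ _),
      mul_finsum, mul_finsum, mul_finsum]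
  have e1 (p : ℤ × ℤ) : f p * arOp θ g p = f p * g (p - 0) - θ.a * (f p * g (p - (1, 0))) -
      θ.b * (f p * g (p - (0, 1))) - θ.c * (f p * g (p - (1, 1))) := by
    rw [arOp, sub_zero]; ring
  have e2 (p : ℤ × ℤ) : arOpAdj θ f p * g p = f (p + 0) * g p - θ.a * (f (p + (1, 0)) * g p) -
      θ.b * (f (p + (0, 1)) * g p) - θ.c * (f (p + (1, 1)) * g p) := by
    rw [arOpAdj, add_zero]; ring
  simp only [e1, e2]
  rw [lin (fun s p ↦ f p * g (p - s)) fin1, lin (fun s p ↦ f (p + s) * g p) fin2]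
  simp only [shift]

/-- Pairing f with the Yule–Walker equation and summing by parts writes v f(0) as the inner product
of x₀ with a combination of orthogonal errors, to which Cauchy–Schwarz applies. -/
lemma IsOrthogonalAR.sq_le {θ : Params} {γ : ℤ × ℤ → ℝ} {x e : ℤ × ℤ → H}
    (h : IsOrthogonalAR θ γ x e) {f : ℤ × ℤ → ℝ} (hf : f.support.Finite) (s : Finset (ℤ × ℤ))
    (hs : (arOpAdj θ f).support ⊆ s) :
    (θ.v * f 0) ^ 2 ≤ γ 0 * (θ.v * ∑ p ∈ s, arOpAdj θ f p ^ 2) := by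
  have h1 : θ.v * f 0 = inner ℝ (x 0) (∑ p ∈ s, arOpAdj θ f p • e (0 - p)) := by
    have := finsum_mul_arOp θ hf (arOpAdj θ γ)
    rw [h.arOp_arOpAdj, finsum_eq_single _ 0 (by intro p hp; simp [hp]), Pi.single_eq_same,
      finsum_eq_sum_of_support_subset (s := s) _
        ((Function.support_mul_subset_left _ _).trans hs)] at this
    rw [mul_comm, this, inner_sum]
    refine Finset.sum_congr rfl fun p _ ↦ ?_
    rw [inner_smul_right, h.inner_error_sub]
  have h2 : inner ℝ (∑ p ∈ s, arOpAdj θ f p • e (0 - p)) (∑ p ∈ s, arOpAdj θ f p • e (0 - p)) =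
      θ.v * ∑ p ∈ s, arOpAdj θ f p ^ 2 := by
    simp only [sum_inner, inner_sum, inner_smul_right, real_inner_smul_left, h.inner_error,
      sub_right_inj, Finset.mul_sum]
    refine Finset.sum_congr rfl fun p hp ↦ ?_
    rw [Finset.sum_eq_single p (by intro q _ hq; simp [hq]) (by simp [hp])]
    simp only [if_true]
    ring
  have h3 : inner ℝ (x 0) (x 0) = γ 0 := by simpa using h.inner_sub 0 0
  rw [← h2, ← h3, h1, sq]
  exact real_inner_mul_inner_self_le _ _

end InnerProductSpace

/-! ### Zeros of the symbol on the torus -/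

/-- Solving for w gives w = (1 - az)/(b + cz), so it suffices that |1 - az| = |b + cz|. This is
linear in cos t for z = exp(it), and the product in the hypothesis is (1 + a² - b² - c²)² - 4(a +
bc)². -/
lemma exists_zero_on_torus {a b c : ℝ}
    (h : (1 - a - b - c) * (1 - a + b + c) * (1 + a - b + c) * (1 + a + b - c) ≤ 0) :
    ∃ z w : ℂ, ‖z‖ = 1 ∧ ‖w‖ = 1 ∧ a * z + b * w + c * (z * w) = 1 := by
  obtain ⟨t, ht⟩ : ∃ t : ℝ, 1 + a ^ 2 - b ^ 2 - c ^ 2 = 2 * (a + b * c) * Real.cos t := by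
    have hsq : (1 + a ^ 2 - b ^ 2 - c ^ 2) ^ 2 ≤ (2 * (a + b * c)) ^ 2 := by linarith
    rcases eq_or_ne (2 * (a + b * c)) 0 with h0 | h0
    · rw [h0] at hsq ⊢
      exact ⟨0, by nlinarith⟩
    · have habs := abs_le.1 ((abs_div _ _).trans_le
        ((div_le_one (abs_pos.2 h0)).2 (sq_le_sq.1 hsq)))
      refine ⟨Real.arccos ((1 + a ^ 2 - b ^ 2 - c ^ 2) / (2 * (a + b * c))), ?_⟩
      rw [Real.cos_arccos habs.1 habs.2, mul_div_cancel₀ _ h0]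
  set z : ℂ := Complex.exp (t * Complex.I) with hz
  have hre : z.re = Real.cos t := Complex.exp_ofReal_mul_I_re t
  have him : z.im = Real.sin t := Complex.exp_ofReal_mul_I_im t
  have hnorm : ‖1 - a * z‖ = ‖b + c * z‖ := by
    rw [← sq_eq_sq₀ (norm_nonneg _) (norm_nonneg _), ← Complex.normSq_eq_norm_sq,
      ← Complex.normSq_eq_norm_sq, Complex.normSq_apply, Complex.normSq_apply]
    simp only [Complex.sub_re, Complex.sub_im, Complex.add_re, Complex.add_im, Complex.mul_re,
      Complex.mul_im, Complex.ofReal_re, Complex.ofReal_im, Complex.one_re, Complex.one_im, hre,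
      him]
    linear_combination ht + (a ^ 2 - c ^ 2) * Real.sin_sq_add_cos_sq t
  refine ⟨z, ?_⟩
  have hz1 : ‖z‖ = 1 := Complex.norm_exp_ofReal_mul_I t
  rcases eq_or_ne (b + c * z) 0 with h0 | h0
  · have h1 : 1 - a * z = 0 := by rwa [h0, norm_zero, norm_eq_zero] at hnorm
    exact ⟨1, hz1, norm_one, by linear_combination h0 - h1⟩
  · refine ⟨(1 - a * z) / (b + c * z), hz1, ?_, ?_⟩
    · rw [norm_div, hnorm, div_self (norm_ne_zero_iff.2 h0)]
    · linear_combination mul_div_cancel₀ (1 - a * z) h0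

/-! ### Logarithmic cutoff and its energy -/

/-- The harmonic numbers, as real numbers. -/
noncomputable def harmonicReal (n : ℕ) : ℝ := ∑ i ∈ Finset.range n, 1 / ((i : ℝ) + 1)

lemma harmonicReal_succ (n : ℕ) : harmonicReal (n + 1) = harmonicReal n + 1 / ((n : ℝ) + 1) :=
  Finset.sum_range_succ _ _

lemma monotone_harmonicReal : Monotone harmonicReal :=
  monotone_nat_of_le_succ fun n ↦ by
    rw [harmonicReal_succ]
    exact le_add_of_nonneg_right (by positivity)

lemma harmonicReal_nonneg (n : ℕ) : 0 ≤ harmonicReal n :=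
  Finset.sum_nonneg fun _ _ ↦ by positivity

lemma abs_harmonicReal_sub_le {m n : ℕ} (h : m ≤ n + 1) (h' : n ≤ m + 1) :
    |harmonicReal m - harmonicReal n| ≤ 2 / ((n : ℝ) + 1) := by
  obtain rfl | rfl | rfl : m = n ∨ m = n + 1 ∨ n = m + 1 := by omega
  · rw [sub_self, abs_zero]; positivity
  · rw [harmonicReal_succ, add_sub_cancel_left, abs_of_nonneg (by positivity)]
    gcongr
    norm_num
  -- Here the increment is 1/n ≤ 2/(n + 1), which is where the factor 2 is needed.
  · rw [harmonicReal_succ, sub_add_cancel_left, abs_neg, abs_of_nonneg (by positivity),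
      div_le_div_iff₀ (by positivity) (by positivity)]
    push_cast
    linarith [(Nat.cast_nonneg m : (0 : ℝ) ≤ m)]

/-- The sup norm on `ℤ × ℤ`. -/
noncomputable def supNorm (p : ℤ × ℤ) : ℕ := max p.1.natAbs p.2.natAbs

/-- The logarithmic cutoff function: `1` at the origin, `0` outside the box of radius `N`. -/
noncomputable def logCutoff (N : ℕ) (p : ℤ × ℤ) : ℝ :=
  max (1 - harmonicReal (supNorm p) / harmonicReal N) 0

/-- The points of sup norm at most `N`. -/
noncomputable def fullBox (N : ℕ) : Finset (ℤ × ℤ) := (Finset.range (N + 1)).biUnion Finset.box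

lemma mem_fullBox {N : ℕ} {p : ℤ × ℤ} : p ∈ fullBox N ↔ supNorm p ≤ N := by
  simp [fullBox, Int.mem_box, supNorm]

variable {N : ℕ}

lemma logCutoff_zero : logCutoff N 0 = 1 := by
  simp [logCutoff, supNorm, harmonicReal]

lemma harmonicReal_pos (hN : N ≠ 0) : 0 < harmonicReal N :=
  Finset.sum_pos (fun _ _ ↦ by positivity) (by simpa using hN)

lemma logCutoff_eq_zero (hN : N ≠ 0) {p : ℤ × ℤ} (hp : N ≤ supNorm p) : logCutoff N p = 0 := by
  refine max_eq_right (sub_nonpos.2 ?_)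
  rw [one_le_div (harmonicReal_pos hN)]
  exact monotone_harmonicReal hp

lemma abs_logCutoff_sub_le {p q : ℤ × ℤ} (h : supNorm p ≤ supNorm q + 1)
    (h' : supNorm q ≤ supNorm p + 1) :
    |logCutoff N q - logCutoff N p| ≤ 2 / ((supNorm p : ℝ) + 1) / harmonicReal N := by
  refine (abs_max_sub_max_le_abs _ _ _).trans ?_ |>.trans
    (div_le_div_of_nonneg_right (abs_harmonicReal_sub_le h' h) (harmonicReal_nonneg N))
  rw [sub_sub_sub_cancel_left, ← sub_div, abs_div, abs_of_nonneg (harmonicReal_nonneg N),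
    abs_sub_comm]

/-- A real character of `ℤ × ℤ` damped by the logarithmic cutoff. -/
noncomputable def testFn (z w : ℂ) (N : ℕ) (p : ℤ × ℤ) : ℝ :=
  (z ^ p.1 * w ^ p.2 * logCutoff N p).re

variable {z w : ℂ}

lemma testFn_zero : testFn z w N 0 = 1 := by
  simp [testFn, logCutoff_zero]

lemma testFn_eq_zero (hN : N ≠ 0) {p : ℤ × ℤ} (hp : N ≤ supNorm p) : testFn z w N p = 0 := by
  simp [testFn, logCutoff_eq_zero hN hp]

lemma finite_support_testFn (hN : N ≠ 0) : (testFn z w N).support.Finite :=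
  (fullBox N).finite_toSet.subset fun _ hp ↦
    mem_fullBox.2 (not_lt.1 fun h ↦ hp (testFn_eq_zero hN h.le))

lemma support_arOpAdj_testFn (θ : Params) (hN : N ≠ 0) :
    (arOpAdj θ (testFn z w N)).support ⊆ fullBox N := by
  refine fun p hp ↦ mem_fullBox.2 (not_lt.1 fun h ↦ hp ?_)
  have : N < max p.1.natAbs p.2.natAbs := h
  -- The cutoff already vanishes at norm N, and a shift lowers the norm by at most one.
  rw [arOpAdj, testFn_eq_zero hN h.le, testFn_eq_zero hN, testFn_eq_zero hN, testFn_eq_zero hN]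
  · ring
  all_goals
    simp only [supNorm, Prod.fst_add, Prod.snd_add]
    omega

/-- The adjoint operator annihilates the character at a zero of P, so only increments of the cutoff
survive. -/
lemma abs_arOpAdj_testFn_le {θ : Params} (hz : ‖z‖ = 1) (hw : ‖w‖ = 1)
    (h0 : θ.a * z + θ.b * w + θ.c * (z * w) = 1) (p : ℤ × ℤ) :
    |arOpAdj θ (testFn z w N) p| ≤
      (|θ.a| + |θ.b| + |θ.c|) * (2 / ((supNorm p : ℝ) + 1) / harmonicReal N) := by
  have hz0 : z ≠ 0 := norm_ne_zero_iff.1 (hz ▸ one_ne_zero)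
  have hw0 : w ≠ 0 := norm_ne_zero_iff.1 (hw ▸ one_ne_zero)
  have e : arOpAdj θ (testFn z w N) p = (z ^ p.1 * w ^ p.2 *
      (θ.a * z * ((logCutoff N p - logCutoff N (p + (1, 0)) : ℝ) : ℂ) +
       θ.b * w * ((logCutoff N p - logCutoff N (p + (0, 1)) : ℝ) : ℂ) +
       θ.c * (z * w) * ((logCutoff N p - logCutoff N (p + (1, 1)) : ℝ) : ℂ))).re := by
    simp only [arOpAdj, testFn, ← Complex.re_ofReal_mul, ← Complex.sub_re]
    congr 1
    simp only [Prod.fst_add, Prod.snd_add, zpow_add₀ hz0, zpow_add₀ hw0, zpow_one, add_zero]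
    push_cast
    linear_combination -(z ^ p.1 * w ^ p.2 * logCutoff N p) * h0
  have hd (s : ℤ × ℤ) (hs : s = (1, 0) ∨ s = (0, 1) ∨ s = (1, 1)) :
      ‖((logCutoff N p - logCutoff N (p + s) : ℝ) : ℂ)‖ ≤
        2 / ((supNorm p : ℝ) + 1) / harmonicReal N := by
    rw [Complex.norm_real, Real.norm_eq_abs, abs_sub_comm]
    apply abs_logCutoff_sub_le <;> rcases hs with rfl | rfl | rfl <;>
      simp only [supNorm, Prod.fst_add, Prod.snd_add] <;> omega
  rw [e]
  refine (Complex.abs_re_le_norm _).trans ?_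
  rw [norm_mul, norm_mul, norm_zpow, norm_zpow, hz, hw, one_zpow, one_zpow, one_mul, one_mul,
    add_mul, add_mul]
  refine norm_add₃_le.trans (add_le_add_three ?_ ?_ ?_) <;>
    simp only [norm_mul, hz, hw, mul_one, Complex.norm_real θ.a, Complex.norm_real θ.b,
      Complex.norm_real θ.c, Real.norm_eq_abs]
  · exact mul_le_mul_of_nonneg_left (hd _ (by simp)) (abs_nonneg _)
  · exact mul_le_mul_of_nonneg_left (hd _ (by simp)) (abs_nonneg _)
  · exact mul_le_mul_of_nonneg_left (hd _ (by simp)) (abs_nonneg _)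

lemma sum_fullBox_le (N : ℕ) :
    ∑ p ∈ fullBox N, (1 / ((supNorm p : ℝ) + 1)) ^ 2 ≤ 8 * harmonicReal (N + 1) := by
  have hbox {p : ℤ × ℤ} {n : ℕ} : p ∈ Finset.box n ↔ supNorm p = n := Int.mem_box
  rw [fullBox, Finset.sum_biUnion, harmonicReal, Finset.mul_sum]
  · refine Finset.sum_le_sum fun n _ ↦ ?_
    rw [Finset.sum_congr rfl fun p hp ↦ by rw [hbox.1 hp], Finset.sum_const, nsmul_eq_mul]
    -- The shell of radius n has 8n points, or one if n = 0; its contribution is thus at most 8/(n +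
    -- 1).
    have hcard : ((Finset.box n : Finset (ℤ × ℤ)).card : ℝ) ≤ 8 * ((n : ℝ) + 1) := by
      rcases eq_or_ne n 0 with rfl | hn
      · simp
      · rw [Int.card_box hn]; push_cast; linarith
    calc _ ≤ 8 * ((n : ℝ) + 1) * (1 / ((n : ℝ) + 1)) ^ 2 := by gcongr
      _ = _ := by field_simp
  · intro m _ n _ hmn
    refine Finset.disjoint_left.2 fun p hp hq ↦ hmn ?_
    rw [← hbox.1 hp, ← hbox.1 hq]

/-- Squared increments contribute H_N⁻² and the sum over shells only O(H_N), leaving O(1/H_N); the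
constant is 4 · 8 · 2. -/
lemma sum_sq_arOpAdj_testFn_le {θ : Params} (hN : N ≠ 0) (hz : ‖z‖ = 1) (hw : ‖w‖ = 1)
    (h0 : θ.a * z + θ.b * w + θ.c * (z * w) = 1) :
    ∑ p ∈ fullBox N, arOpAdj θ (testFn z w N) p ^ 2 ≤
      64 * (|θ.a| + |θ.b| + |θ.c|) ^ 2 / harmonicReal N := by
  have hpos := harmonicReal_pos hN
  have h2 : harmonicReal (N + 1) ≤ 2 * harmonicReal N := by
    have h1 : harmonicReal 1 ≤ harmonicReal N :=
      monotone_harmonicReal (Nat.one_le_iff_ne_zero.2 hN)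
    have h1' : harmonicReal 1 = 1 := by simp [harmonicReal]
    have h3 : 1 / ((N : ℝ) + 1) ≤ 1 := by
      rw [div_le_one (by positivity)]; linarith [(Nat.cast_nonneg N : (0 : ℝ) ≤ N)]
    rw [harmonicReal_succ]
    linarith
  set K := |θ.a| + |θ.b| + |θ.c|
  calc _ ≤ ∑ p ∈ fullBox N, (4 * K ^ 2 / harmonicReal N ^ 2) * (1 / ((supNorm p : ℝ) + 1)) ^ 2 := by
        refine Finset.sum_le_sum fun p _ ↦ ?_
        refine (sq_le_sq' (neg_le_of_abs_le (abs_arOpAdj_testFn_le hz hw h0 p))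
          (le_of_abs_le (abs_arOpAdj_testFn_le hz hw h0 p))).trans_eq ?_
        ring
    _ ≤ (4 * K ^ 2 / harmonicReal N ^ 2) * (8 * (2 * harmonicReal N)) := by
        rw [← Finset.mul_sum]
        exact mul_le_mul_of_nonneg_left ((sum_fullBox_le N).trans (by linarith)) (by positivity)
    _ = _ := by field_simp; ring

lemma tendsto_harmonicReal : Filter.Tendsto harmonicReal Filter.atTop Filter.atTop :=
  Real.tendsto_sum_range_one_div_nat_succ_atTop

/-- The zeros of `P` on the torus rule out stationary solutions. -/
lemma IsOrthogonalAR.mem_paramSet {H : Type*} [NormedAddCommGroup H] [InnerProductSpace ℝ H]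
    {θ : Params} {γ : ℤ × ℤ → ℝ} {x e : ℤ × ℤ → H} (h : IsOrthogonalAR θ γ x e) (hv : 0 < θ.v) :
    θ ∈ paramSet := by
  refine ⟨not_le.1 fun hle ↦ ?_, hv⟩
  obtain ⟨z, w, hz, hw, h0⟩ := exists_zero_on_torus hle
  have hγ : 0 ≤ γ 0 := by
    have := h.inner_sub 0 0
    rw [sub_zero] at this
    exact this ▸ real_inner_self_nonneg
  have bound : ∀ᶠ N in Filter.atTop, θ.v ^ 2 ≤
      γ 0 * (θ.v * (64 * (|θ.a| + |θ.b| + |θ.c|) ^ 2 / harmonicReal N)) := by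
    filter_upwards [Filter.eventually_ne_atTop 0] with N hN
    have := h.sq_le (finite_support_testFn hN) (fullBox N)
      (support_arOpAdj_testFn (z := z) (w := w) θ hN)
    rw [testFn_zero, mul_one] at this
    exact this.trans (mul_le_mul_of_nonneg_left (mul_le_mul_of_nonneg_left
      (sum_sq_arOpAdj_testFn_le hN hz hw h0) hv.le) hγ)
  have lim := ((tendsto_harmonicReal.const_div_atTop
    (64 * (|θ.a| + |θ.b| + |θ.c|) ^ 2)).const_mul θ.v).const_mul (γ 0)
  rw [mul_zero, mul_zero] at lim
  exact absurd (ge_of_tendsto lim bound) (not_le.2 (by positivity))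

/-! ### From random fields to L² -/

section Fields

variable {Ω : Type*} [MeasurableSpace Ω] {μ : Measure Ω} [IsProbabilityMeasure μ]

lemma memLp_sub_integral {Y : Ω → ℝ} (hY : MemLp Y 2 μ) : MemLp (fun ω ↦ Y ω - μ[Y]) 2 μ :=
  hY.sub (memLp_const _)

lemma inner_toLp_sub_integral {Y Z : Ω → ℝ} (hY : MemLp Y 2 μ) (hZ : MemLp Z 2 μ) :
    inner ℝ ((memLp_sub_integral hY).toLp _) ((memLp_sub_integral hZ).toLp _) = cov[Y, Z; μ] := by
  rw [L2.inner_def, covariance]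
  refine integral_congr_ae ?_
  filter_upwards [(memLp_sub_integral hY).coeFn_toLp, (memLp_sub_integral hZ).coeFn_toLp]
    with ω h1 h2
  rw [h1, h2]
  simp [mul_comm]

/-- The centred variables of a stationary autoregressive field, as elements of `L²`. -/
lemma IsStationaryAR.isOrthogonalAR {θ : Params} {X ε : ℤ → ℤ → Ω → ℝ}
    (h : IsStationaryAR θ X ε μ) :
    IsOrthogonalAR θ (fun p ↦ autocov X μ p.1 p.2)
      (fun p ↦ (memLp_sub_integral (h.stationary.memLp p.1 p.2)).toLp _)
      (fun p ↦ (memLp_sub_integral (h.noise.memLp p.1 p.2)).toLp _) where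
  inner_sub p k := by
    exact (inner_toLp_sub_integral (h.stationary.memLp _ _) (h.stationary.memLp _ _)).trans
      (h.stationary.cov_eq _ _ _ _)
  inner_error p q := by
    rw [inner_toLp_sub_integral (h.noise.memLp _ _) (h.noise.memLp _ _)]
    split_ifs with hpq
    · rw [hpq, covariance_self (h.noise.memLp _ _).aestronglyMeasurable.aemeasurable,
        h.noise.variance_eq]
    · exact h.noise.uncorrelated _ _ _ _ hpq
  error_eq p := by
    have hint (i j : ℤ) : Integrable (X i j) μ := (h.stationary.memLp i j).integrable one_le_two
    -- Taking expectations in the equation shows that the centred variables satisfy it too.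
    have hmean : μ[ε p.1 p.2] = μ[X p.1 p.2] - θ.a * μ[X (p.1 - 1) p.2] -
        θ.b * μ[X p.1 (p.2 - 1)] - θ.c * μ[X (p.1 - 1) (p.2 - 1)] := by
      rw [← integral_const_mul, ← integral_const_mul, ← integral_const_mul,
        ← integral_sub (hint _ _) ((hint _ _).const_mul _), ← integral_sub _ ((hint _ _).const_mul _),
        ← integral_sub _ ((hint _ _).const_mul _)]
      · refine integral_congr_ae ?_
        filter_upwards [h.equation p.1 p.2] with ω hω
        linarith
      · exact ((hint _ _).sub ((hint _ _).const_mul _)).sub ((hint _ _).const_mul _)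
      · exact (hint _ _).sub ((hint _ _).const_mul _)
    rw [← MemLp.toLp_const_smul, ← MemLp.toLp_const_smul, ← MemLp.toLp_const_smul, ← MemLp.toLp_sub,
      ← MemLp.toLp_sub, ← MemLp.toLp_sub, MemLp.toLp_eq_toLp_iff]
    filter_upwards [h.equation p.1 p.2] with ω hω
    simp only [Pi.sub_apply, Pi.smul_apply, smul_eq_mul, Prod.fst_sub, Prod.snd_sub, sub_zero]
    rw [hmean]
    linarith

end Fields

end PlanarAR

theorem mainTheorem9 {Ω₁ Ω₂ : Type*} [MeasurableSpace Ω₁] [MeasurableSpace Ω₂]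
    (μ₁ : Measure Ω₁) (μ₂ : Measure Ω₂) [IsProbabilityMeasure μ₁] [IsProbabilityMeasure μ₂]
    (θ₁ θ₂ : PlanarAR.Params)
    (X₁ ε₁ : ℤ → ℤ → Ω₁ → ℝ) (X₂ ε₂ : ℤ → ℤ → Ω₂ → ℝ)
    (h₁ : PlanarAR.IsStationaryAR θ₁ X₁ ε₁ μ₁)
    (h₂ : PlanarAR.IsStationaryAR θ₂ X₂ ε₂ μ₂)
    (hcov : ∀ k l : ℤ, PlanarAR.autocov X₁ μ₁ k l = PlanarAR.autocov X₂ μ₂ k l) :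
    PlanarAR.RelatedAsRows θ₁ θ₂ ∧
      ∃ m : PlanarAR.Row, θ₁ ∈ m.domain ∧ θ₂ = m.map θ₁ := by
  have hθ₁ := h₁.isOrthogonalAR.mem_paramSet h₁.noise.var_pos
  have e₁ := h₁.isOrthogonalAR.arOp_arOpAdj
  have e₂ := h₂.isOrthogonalAR.arOp_arOpAdj
  simp only [← hcov] at e₂
  obtain ⟨m, hm, hmap⟩ :=
    PlanarAR.exists_row_of_arOp_arOpAdj_eq hθ₁ h₂.noise.var_pos e₁ e₂
  -- The table is built from θ₁ itself.
  exact ⟨⟨θ₁, hθ₁, .identity, m, hθ₁, hm, rfl, hmap⟩, m, hm, hmap⟩
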